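/- All graphs are finite and simple. For a graph $H$ let $iso(H)$ denote the number of isolated vertices (vertices of degree $0$) of $H$; for $S\subseteq V(H)$ let $H-S$ be the subgraph induced by $V(H)\setminus S$, and for an edge $e$ let $H-e$ be $H$ with the edge $e$ deleted. For real numbers $a\le b$, a fractional $[a,b]$-factor of $H$ is a function $h\colon E(H)\to[0,1]$ such that $a\le\sum_{e\ni v}h(e)\le b$ for every $v\in V(H)$. For a set $\mathcal{G}$ of graphs, a $\mathcal{G}$-factor of $H$ is a spanning subgraph $F$ of $H$ such that every connected component of $F$ is isomorphic to an element of $\mathcal{G}$. Let $C_k$ denote the circuit with $k$ vertices. For integers $0<m<n$ let $\mathcal{T}_{\frac nm}$ be the set of trees $T$ such that - $iso(T-S)\le\frac nm|S|$ for all $S\subseteq V(T)$, and - for every $e\in E(T)$ there is a set $S^*\subseteq V(T)$ with $iso((T-e)-S^*)>\frac nm|S^*|$. **Theorem.** Let $G$ be a finite simple graph and let $n,m$ be integers with $0<m<n$. Then the following statements are equivalent: 1. $iso(G-S)\le\frac nm|S|$ for every $S\subseteq V(G)$. 2. $G$ has a fractional $[1,\frac nm]$-factor. 3. $G$ has a fractional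 $[1,\frac nm]$-factor with values in $\{0,\frac1m,\dots,\frac{m-1}m,1\}$. 4. $G$ has a $\{C_{2i+1},T : i\in\mathbb{Z},\ 1\le i<\frac m{n-m},\ T\in\mathcal{T}_{\frac nm}\}$-factor. -/

import Mathlib

namespace IsoFactor

/-- The number of isolated vertices of a graph. -/
noncomputable def iso {V : Type*} (G : SimpleGraph V) : ℕ :=
  {v : V | G.IsIsolated v}.ncard

/-- The graph `G - S`: the subgraph of `G` induced by the complement of `S`. -/
def deleteVerts {V : Type*} (G : SimpleGraph V) (S : Finset V) :
    SimpleGraph ((S : Set V)ᶜ : Set V) :=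
  G.induce ((S : Set V)ᶜ)

/-- The fractional degree `d^h(v)`: the sum of `h` over the edges incident with `v`. -/
noncomputable def fracDegree {V : Type*} [Fintype V] (G : SimpleGraph V)
    (h : G.edgeSet → ℝ) (v : V) : ℝ :=
  open Classical in ∑ e : G.edgeSet, if v ∈ (e : Sym2 V) then h e else 0

/-- A fractional `[a, b]`-factor of `G`: a function on the edges with values in `[0, 1]` all of
whose fractional degrees lie in `[a, b]`. -/
def IsFractionalFactor {V : Type*} [Fintype V] (G : SimpleGraph V) (a b : ℝ)
    (h : G.edgeSet → ℝ) : Prop :=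
  (∀ e, h e ∈ Set.Icc (0 : ℝ) 1) ∧ ∀ v, fracDegree G h v ∈ Set.Icc a b

/-- A set of finite graphs; vertex sets are normalised to `Fin k`, because membership only matters
up to isomorphism. -/
abbrev GraphFamily : Type := Set (Σ k : ℕ, SimpleGraph (Fin k))

/-- `F` is a `𝒢`-factor of `G`: a spanning subgraph of `G` every component of which is isomorphic
to an element of `𝒢`. -/
def IsComponentFactor {V : Type*} (G : SimpleGraph V) (𝒢 : GraphFamily)
    (F : SimpleGraph V) : Prop :=
  F ≤ G ∧ ∀ c : F.ConnectedComponent, ∃ H ∈ 𝒢, Nonempty (c.toSimpleGraph ≃g H.2)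

/-- The family `𝒯_{n/m}`: the trees `T` with `iso (T - S) ≤ (n/m) |S|` for all sets `S` of
vertices, such that for each edge `e` the graph `T - e` fails this condition. -/
def treeFamily (n m : ℕ) : GraphFamily :=
  {T | T.2.IsTree ∧
    (∀ S : Finset (Fin T.1), (iso (deleteVerts T.2 S) : ℝ) ≤ (n : ℝ) / m * S.card) ∧
    ∀ e ∈ T.2.edgeSet, ∃ S : Finset (Fin T.1),
      (n : ℝ) / m * S.card < (iso (deleteVerts (T.2.deleteEdges {e}) S) : ℝ)}

/-- The circuits `C_{2i+1}` with `1 ≤ i < m/(n-m)`. -/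
def oddCircuitFamily (n m : ℕ) : GraphFamily :=
  {C | ∃ i : ℕ, 1 ≤ i ∧ (i : ℝ) < (m : ℝ) / ((n : ℝ) - m) ∧
    C = ⟨2 * i + 1, SimpleGraph.cycleGraph (2 * i + 1)⟩}

end IsoFactor

/-! The cycle of implications is 1 → 4 → 3 → 2 → 1. A fractional factor is treated as a symmetric
matrix of nonnegative weights with row sums in `[1, n/m]`; the bound `1` on single weights is
dropped, since truncating at `1` restores it.

The isolated-vertex condition yields an integer matrix supported on adjacent pairs, with row and
column sums in `[m, n]`, by Hall's theorem (`exists_nat_matrix`). Symmetrising it gives real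
weights. In a bipartite graph no symmetrising is needed and the weights are multiples of `1/m`.

For 1 → 4, take a minimal spanning subgraph that still has a weighting. No weighting of it vanishes
on an edge, so perturbing a weighting is severely restricted (`IsTight.nonneg`). Hence the incidence
map is injective and a component has at most as many edges as vertices. A component with fewer edges
is a tree, minimal and so in the tree family. In case of equality the incidence map is bijective,
which excludes leaves and bipartiteness: the component is an odd circuit, and a long one could lose
an edge.

For 4 → 3, trees are bipartite and odd circuits are weighted by hand. Double counting gives 2 → 1.
-/

namespace IsoFactor

open Finset SimpleGraph

/-! ### Hall's theorem on the bipartite double cover -/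

section

variable {V : Type*} [Fintype V]

open Classical in
theorem iso_deleteVerts (G : SimpleGraph V) (S : Finset V) :
    iso (deleteVerts G S) = #{v | v ∉ S ∧ ∀ u, u ∉ S → ¬ G.Adj v u} := by
  have h : ((↑) : ((S : Set V)ᶜ : Set V) → V) '' {v | (deleteVerts G S).IsIsolated v} =
      ({v | v ∉ S ∧ ∀ u, u ∉ S → ¬ G.Adj v u} : Finset V) := by
    ext v
    simp [deleteVerts, IsIsolated, and_comm]
  rw [iso, ← Set.ncard_image_of_injective _ Subtype.val_injective, h, Set.ncard_coe_finset]

open Classical in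
/-- The neighbourhood of a set of vertices. -/
noncomputable def nbhd (G : SimpleGraph V) (A : Finset V) : Finset V := {v | ∃ a ∈ A, G.Adj a v}

theorem mem_nbhd {G : SimpleGraph V} {A : Finset V} {v : V} :
    v ∈ nbhd G A ↔ ∃ a ∈ A, G.Adj a v := by
  simp [nbhd]

/-- Vertices of `A` outside `N(A)` have all their neighbours in `N(A) \ A`, so they become isolated
when that set is removed. The common part `A ∩ N(A)` is absorbed by `m ≤ n`. -/
theorem card_le_card_nbhd {G : SimpleGraph V} {n m : ℕ} (hmn : m ≤ n)
    (h : ∀ S : Finset V, m * iso (deleteVerts G S) ≤ n * #S) (A : Finset V) :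
    m * #A ≤ n * #(nbhd G A) := by
  classical
  have h1 : #(A \ nbhd G A) ≤ iso (deleteVerts G (nbhd G A \ A)) := by
    rw [iso_deleteVerts]
    refine card_le_card fun v hv ↦ ?_
    rw [mem_sdiff] at hv
    simp only [mem_filter, mem_univ, true_and, mem_sdiff, not_and, not_not]
    refine ⟨fun h ↦ absurd h hv.2, fun u hu huv ↦ hv.2 ?_⟩
    exact mem_nbhd.2 ⟨u, hu (mem_nbhd.2 ⟨v, hv.1, huv⟩), huv.symm⟩
  have h2 := h (nbhd G A \ A)
  have h3 := card_sdiff_add_card_inter A (nbhd G A)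
  have h4 := card_sdiff_add_card_inter (nbhd G A) A
  rw [inter_comm] at h4
  rw [← h3, ← h4]
  nlinarith [Nat.mul_le_mul_left m h1, Nat.mul_le_mul_right #(A ∩ nbhd G A) hmn]

/-- Copies with index below `m` must be matched along edges of `G`, which produces the lower bound
`m`; the remaining `n - m` copies are slack that may be matched among themselves. -/
theorem exists_perfect_matching_copies {G : SimpleGraph V} {n m : ℕ} (hmn : m ≤ n)
    (h : ∀ S : Finset V, m * iso (deleteVerts G S) ≤ n * #S) :
    ∃ f : V × Fin n → V × Fin n, Function.Bijective f ∧
      ∀ x, G.Adj x.1 (f x).1 ∨ (m ≤ x.2.val ∧ m ≤ (f x).2.val) := by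
  classical
  have key := card_le_card_nbhd hmn h
  have hlow : #({i | i.val < m} : Finset (Fin n)) = m := by
    rw [Fin.card_filter_val_lt, min_eq_right hmn]
  have hhigh : #({i | m ≤ i.val} : Finset (Fin n)) = n - m := by
    have := card_filter_add_card_filter_not (s := (univ : Finset (Fin n))) (fun i ↦ i.val < m)
    simp only [not_lt, card_univ, Fintype.card_fin] at this
    omega
  obtain ⟨f, hf, hr⟩ := (Fintype.all_card_le_filter_rel_iff_exists_injective
    (fun x y : V × Fin n ↦ G.Adj x.1 y.1 ∨ (m ≤ x.2.val ∧ m ≤ y.2.val))).1 (fun A ↦ by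
    set B : Finset V := A.image Prod.fst with hB
    by_cases hA : ∃ x ∈ A, m ≤ x.2.val
    · obtain ⟨x, hx, hxm⟩ := hA
      have h1 : A ⊆ B ×ˢ univ := fun y hy ↦ by
        simp only [mem_product, mem_univ, and_true]
        exact mem_image_of_mem _ hy
      have h2 : (nbhd G B ×ˢ univ) ∪ ((nbhd G B)ᶜ ×ˢ ({i | m ≤ i.val} : Finset (Fin n))) ⊆
          ({b | ∃ a ∈ A, G.Adj a.1 b.1 ∨ (m ≤ a.2.val ∧ m ≤ b.2.val)} :
            Finset (V × Fin n)) := by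
        intro y hy
        simp only [mem_union, mem_product, mem_univ, and_true, mem_filter, true_and] at hy ⊢
        rcases hy with hy | hy
        · obtain ⟨a, ha, hay⟩ := mem_nbhd.1 hy
          obtain ⟨z, hz, rfl⟩ := mem_image.1 ha
          exact ⟨z, hz, Or.inl hay⟩
        · exact ⟨x, hx, Or.inr ⟨hxm, hy.2⟩⟩
      -- Hall's inequality `n|B| ≤ n|N(B)| + (n - m)|N(B)ᶜ|` amounts to `m|N(B)ᶜ| ≤ n|Bᶜ|`, which is
      -- the expansion property of `N(B)ᶜ`.
      have h3 : nbhd G (nbhd G B)ᶜ ⊆ Bᶜ := fun v hv ↦ by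
        obtain ⟨a, ha, hav⟩ := mem_nbhd.1 hv
        rw [mem_compl] at ha ⊢
        exact fun hvB ↦ ha (mem_nbhd.2 ⟨v, hvB, hav.symm⟩)
      have h4 := card_le_card h1
      have h5 := card_le_card h2
      rw [card_union_of_disjoint, card_product, card_product, hhigh] at h5
      · rw [card_product] at h4
        simp only [card_univ, Fintype.card_fin] at h4 h5
        refine h4.trans (le_trans ?_ h5)
        have h6 := key (nbhd G B)ᶜ
        have h7 := Nat.mul_le_mul_left n (card_le_card h3)
        have h8 := card_add_card_compl (nbhd G B)
        have h9 := card_add_card_compl B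
        obtain ⟨d, rfl⟩ := Nat.exists_eq_add_of_le hmn
        rw [Nat.add_sub_cancel_left]
        nlinarith
      · rw [Finset.disjoint_left]
        intro y hy hy'
        simp only [mem_product, mem_compl] at hy hy'
        exact hy'.1 hy.1
    · push Not at hA
      have h1 : A ⊆ B ×ˢ ({i | i.val < m} : Finset (Fin n)) := fun y hy ↦ by
        simp only [mem_product, mem_filter, mem_univ, true_and]
        exact ⟨mem_image_of_mem _ hy, hA y hy⟩
      have h2 : nbhd G B ×ˢ univ ⊆
          ({b | ∃ a ∈ A, G.Adj a.1 b.1 ∨ (m ≤ a.2.val ∧ m ≤ b.2.val)} :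
            Finset (V × Fin n)) := by
        intro y hy
        simp only [mem_product, mem_univ, and_true, mem_filter, true_and] at hy ⊢
        obtain ⟨a, ha, hay⟩ := mem_nbhd.1 hy
        obtain ⟨z, hz, rfl⟩ := mem_image.1 ha
        exact ⟨z, hz, Or.inl hay⟩
      have h4 := card_le_card h1
      have h5 := card_le_card h2
      rw [card_product, hlow] at h4
      rw [card_product] at h5
      simp only [card_univ, Fintype.card_fin] at h5
      have := key B
      nlinarith)
  exact ⟨f, Finite.injective_iff_bijective.1 hf, hr⟩

/-- A bipartite form of the fractional factor theorem, on the bipartite double cover of `G`. -/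
theorem exists_nat_matrix {G : SimpleGraph V} {n m : ℕ} (hmn : m ≤ n)
    (h : ∀ S : Finset V, m * iso (deleteVerts G S) ≤ n * #S) :
    ∃ p : V → V → ℕ, (∀ u v, p u v ≠ 0 → G.Adj u v) ∧
      ∀ v, (m ≤ ∑ u, p v u ∧ ∑ u, p v u ≤ n) ∧ (m ≤ ∑ u, p u v ∧ ∑ u, p u v ≤ n) := by
  classical
  obtain ⟨f, hf, hr⟩ := exists_perfect_matching_copies hmn h
  have hlow : #({i | i.val < m} : Finset (Fin n)) = m := by
    rw [Fin.card_filter_val_lt, min_eq_right hmn]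
  have hrow (v : V) : ∑ u, #({i | (f (v, i)).1 = u ∧ G.Adj v u} : Finset (Fin n)) =
      #({i | G.Adj v (f (v, i)).1} : Finset (Fin n)) := by
    rw [card_eq_sum_card_fiberwise (f := fun i ↦ (f (v, i)).1) (t := univ) (by simp)]
    refine sum_congr rfl fun u _ ↦ congrArg card ?_
    ext i
    simp only [mem_filter, mem_univ, true_and]
    constructor
    · rintro ⟨rfl, h⟩; exact ⟨h, rfl⟩
    · rintro ⟨h, rfl⟩; exact ⟨rfl, h⟩
  set e : V × Fin n ≃ V × Fin n := Equiv.ofBijective f hf with he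
  have hfe (x) : f (e.symm x) = x := e.apply_symm_apply x
  -- Column sums are row sums of the inverse matching.
  have hcol (v : V) : ∑ u, #({i | (f (u, i)).1 = v ∧ G.Adj u v} : Finset (Fin n)) =
      #({j | G.Adj (e.symm (v, j)).1 v} : Finset (Fin n)) := by
    rw [card_eq_sum_card_fiberwise (f := fun j ↦ (e.symm (v, j)).1) (t := univ) (by simp)]
    refine sum_congr rfl fun u _ ↦ ?_
    refine card_bij' (fun i _ ↦ (f (u, i)).2) (fun j _ ↦ (e.symm (v, j)).2) ?_ ?_ ?_ ?_
    · intro i hi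
      simp only [mem_filter, mem_univ, true_and] at hi ⊢
      have : e.symm (v, (f (u, i)).2) = (u, i) := by
        rw [Equiv.symm_apply_eq]
        exact Prod.ext hi.1.symm rfl
      rw [this]
      exact ⟨hi.2, rfl⟩
    · intro j hj
      simp only [mem_filter, mem_univ, true_and] at hj ⊢
      have : (u, (e.symm (v, j)).2) = e.symm (v, j) := Prod.ext hj.2.symm rfl
      rw [this, hfe]
      exact ⟨rfl, hj.2 ▸ hj.1⟩
    · intro i hi
      simp only [mem_filter, mem_univ, true_and] at hi
      have : e.symm (v, (f (u, i)).2) = (u, i) := by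
        rw [Equiv.symm_apply_eq]
        exact Prod.ext hi.1.symm rfl
      rw [this]
    · intro j hj
      simp only [mem_filter, mem_univ, true_and] at hj
      have : (u, (e.symm (v, j)).2) = e.symm (v, j) := Prod.ext hj.2.symm rfl
      rw [this, hfe]
  refine ⟨fun u v ↦ #({i | (f (u, i)).1 = v ∧ G.Adj u v} : Finset (Fin n)), ?_, ?_⟩
  · intro u v huv
    obtain ⟨i, hi⟩ := card_ne_zero.1 huv
    exact (mem_filter.1 hi).2.2
  · intro v
    rw [hrow, hcol]
    refine ⟨⟨?_, ?_⟩, ?_, ?_⟩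
    · conv_lhs => rw [← hlow]
      refine card_le_card fun i hi ↦ ?_
      simp only [mem_filter, mem_univ, true_and] at hi ⊢
      exact (hr (v, i)).resolve_right fun h ↦ by simp at h; omega
    · exact (card_le_univ _).trans_eq (Fintype.card_fin n)
    · conv_lhs => rw [← hlow]
      refine card_le_card fun j hj ↦ ?_
      simp only [mem_filter, mem_univ, true_and] at hj ⊢
      have := hr (e.symm (v, j))
      rw [hfe] at this
      exact this.resolve_right fun h ↦ by simp at h; omega
    · exact (card_le_univ _).trans_eq (Fintype.card_fin n)

end

/-! ### Weightings and fractional factors -/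

section

/-- Symmetric edge weights with values in `A`, all of whose vertex sums lie in `[1, b]`. -/
structure IsWeighting {V : Type*} [Fintype V] (G : SimpleGraph V) (A : Set ℝ) (b : ℝ)
    (w : V → V → ℝ) : Prop where
  symm : ∀ u v, w u v = w v u
  mem : ∀ u v, w u v ∈ A
  adj : ∀ u v, w u v ≠ 0 → G.Adj u v
  one_le : ∀ v, 1 ≤ ∑ u, w v u
  le : ∀ v, ∑ u, w v u ≤ b

/-- `G` has a weighting with values in `A` and vertex sums in `[1, b]`. -/
def HasWeighting {V : Type*} [Fintype V] (G : SimpleGraph V) (A : Set ℝ) (b : ℝ) : Prop :=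
  ∃ w, IsWeighting G A b w

/-- The nonnegative rationals with denominator `m`. -/
def grid (m : ℕ) : Set ℝ := {x | ∃ k : ℕ, x = (k : ℝ) / m}

theorem grid_subset (m : ℕ) : grid m ⊆ Set.Ici 0 := by
  rintro _ ⟨k, rfl⟩
  exact Set.mem_Ici.2 (by positivity)

variable {V : Type*} {G : SimpleGraph V}

open Classical in
/-- The symmetric matrix of an edge function. -/
noncomputable def edgeMatrix (G : SimpleGraph V) (z : G.edgeSet → ℝ) (u v : V) : ℝ :=
  if h : G.Adj u v then z ⟨s(u, v), h⟩ else 0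

theorem edgeMatrix_symm (z : G.edgeSet → ℝ) (u v : V) :
    edgeMatrix G z u v = edgeMatrix G z v u := by
  unfold edgeMatrix
  by_cases h : G.Adj u v
  · rw [dif_pos h, dif_pos h.symm]
    congr 2
    exact Sym2.eq_swap
  · rw [dif_neg h, dif_neg fun h' ↦ h h'.symm]

theorem edgeMatrix_adj (z : G.edgeSet → ℝ) (u v : V) (h : edgeMatrix G z u v ≠ 0) :
    G.Adj u v := by
  by_contra h'
  exact h (dif_neg h')

/-- The edge function of a symmetric matrix. -/
def edgeFun (G : SimpleGraph V) (w : V → V → ℝ) (hw : ∀ u v, w u v = w v u) (e : G.edgeSet) : ℝ :=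
  Sym2.lift ⟨w, hw⟩ e

theorem edgeMatrix_edgeFun {w : V → V → ℝ} (hw : ∀ u v, w u v = w v u)
    (h : ∀ u v, w u v ≠ 0 → G.Adj u v) : edgeMatrix G (edgeFun G w hw) = w := by
  ext u v
  by_cases huv : G.Adj u v
  · exact dif_pos huv
  · rw [edgeMatrix, dif_neg huv]
    by_contra h0
    exact huv (h u v (Ne.symm h0))

theorem mul_iso_le_iff {n m : ℕ} (hm : 0 < m) :
    (∀ S : Finset V, (iso (deleteVerts G S) : ℝ) ≤ (n : ℝ) / m * #S) ↔
      ∀ S : Finset V, m * iso (deleteVerts G S) ≤ n * #S := by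
  refine forall_congr' fun S ↦ ?_
  have hm' : (0 : ℝ) < m := by exact_mod_cast hm
  rw [div_mul_eq_mul_div, le_div_iff₀ hm', mul_comm]
  exact_mod_cast Iff.rfl

variable [Fintype V]

theorem fracDegree_eq_sum (z : G.edgeSet → ℝ) (v : V) :
    fracDegree G z v = ∑ u, edgeMatrix G z v u := by
  classical
  have h1 : ∑ u : G.neighborSet v, z ⟨s(v, u), u.2⟩ = ∑ u, edgeMatrix G z v u := by
    refine sum_of_injOn Subtype.val Subtype.val_injective.injOn (by simp) ?_ ?_
    · intro u _ hu
      refine dif_neg fun h ↦ hu ?_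
      simpa using h
    · intro u _
      have hu : G.Adj v u := u.2
      rw [edgeMatrix, dif_pos hu]
  rw [← h1, fracDegree]
  symm
  refine sum_of_injOn (fun u : G.neighborSet v ↦ (⟨s(v, u), u.2⟩ : G.edgeSet)) ?_
    (by simp) ?_ ?_
  · intro u _ u' _ h
    exact Subtype.ext (Sym2.congr_right.1 (congrArg Subtype.val h))
  · rintro ⟨e, he⟩ _ hu
    refine if_neg fun hv ↦ hu ?_
    obtain ⟨u, rfl⟩ := Sym2.mem_iff_exists.1 hv
    exact ⟨⟨u, he⟩, by simp⟩
  · intro u _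
    exact (if_pos (Sym2.mem_mk_left _ _)).symm

/-- Replacing each weight by its minimum with `1` keeps the vertex sums at least `1`. -/
theorem one_le_sum_min {w : V → ℝ} (h0 : ∀ u, 0 ≤ w u) (h1 : 1 ≤ ∑ u, w u) :
    1 ≤ ∑ u, min (w u) 1 := by
  by_cases h : ∃ u, 1 ≤ w u
  · obtain ⟨u, hu⟩ := h
    calc (1 : ℝ) = min (w u) 1 := (min_eq_right hu).symm
      _ ≤ _ := single_le_sum (f := fun u ↦ min (w u) 1)
        (fun v _ ↦ le_min (h0 v) zero_le_one) (mem_univ u)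
  · push Not at h
    rwa [sum_congr rfl fun u _ ↦ min_eq_left (h u).le]

/-- Entries of a weighting may exceed `1`; truncation at `1` does not increase vertex sums and keeps
them at least `1`. -/
theorem IsWeighting.exists_isFractionalFactor {A : Set ℝ} {b : ℝ} {w : V → V → ℝ}
    (hw : IsWeighting G A b w) (hA : A ⊆ Set.Ici 0) :
    ∃ h : G.edgeSet → ℝ, IsFractionalFactor G 1 b h ∧ ∀ e, ∃ x ∈ A, h e = min x 1 := by
  have hs : ∀ u v, min (w u v) 1 = min (w v u) 1 := fun u v ↦ by rw [hw.symm]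
  have h0 : ∀ u v, 0 ≤ w u v := fun u v ↦ hA (hw.mem u v)
  have hM := edgeMatrix_edgeFun (G := G) (w := fun u v ↦ min (w u v) 1) hs fun u v h ↦
    hw.adj u v fun h' ↦ h (by simp [h'])
  have he : ∀ e, ∃ x ∈ A, edgeFun G _ hs e = min x 1 := by
    rintro ⟨e, he⟩
    induction e using Sym2.ind with
    | _ u v => exact ⟨w u v, hw.mem u v, rfl⟩
  refine ⟨edgeFun G _ hs, ⟨fun e ↦ ?_, fun v ↦ ?_⟩, he⟩
  · obtain ⟨x, hx, h⟩ := he e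
    rw [h]
    exact ⟨le_min (hA hx) zero_le_one, min_le_right _ _⟩
  · rw [fracDegree_eq_sum, hM]
    exact ⟨one_le_sum_min (h0 v) (hw.one_le v),
      (sum_le_sum fun u _ ↦ min_le_left _ _).trans (hw.le v)⟩

theorem IsFractionalFactor.isWeighting {b : ℝ} {h : G.edgeSet → ℝ}
    (hh : IsFractionalFactor G 1 b h) : IsWeighting G (Set.Ici 0) b (edgeMatrix G h) where
  symm := edgeMatrix_symm h
  mem u v := by
    unfold edgeMatrix
    split_ifs
    · exact (hh.1 _).1
    · exact Set.mem_Ici.2 le_rfl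
  adj := edgeMatrix_adj h
  one_le v := (hh.2 v).1.trans_eq (fracDegree_eq_sum h v)
  le v := (fracDegree_eq_sum h v).ge.trans (hh.2 v).2

/-- Vertices isolated in `G - S` send all their weight, at least `1` each, into `S`, where each
vertex receives at most `b`. -/
theorem IsWeighting.iso_le {b : ℝ} {w : V → V → ℝ} (hw : IsWeighting G (Set.Ici 0) b w)
    (S : Finset V) : (iso (deleteVerts G S) : ℝ) ≤ b * #S := by
  classical
  rw [iso_deleteVerts]
  set I : Finset V := {v | v ∉ S ∧ ∀ u, u ∉ S → ¬ G.Adj v u} with hI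
  calc (#I : ℝ) = ∑ v ∈ I, (1 : ℝ) := by simp
    _ ≤ ∑ v ∈ I, ∑ u, w v u := sum_le_sum fun v _ ↦ hw.one_le v
    _ = ∑ v ∈ I, ∑ u ∈ S, w v u := sum_congr rfl fun v hv ↦ by
      refine (sum_subset (subset_univ S) fun u _ hu ↦ ?_).symm
      by_contra h
      exact (mem_filter.1 hv).2.2 u hu (hw.adj v u h)
    _ = ∑ u ∈ S, ∑ v ∈ I, w u v := by
      rw [sum_comm]
      exact sum_congr rfl fun u _ ↦ sum_congr rfl fun v _ ↦ hw.symm v u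
    _ ≤ ∑ u ∈ S, b := sum_le_sum fun u _ ↦
      (sum_le_sum_of_subset_of_nonneg (subset_univ I) fun v _ _ ↦ hw.mem u v).trans (hw.le u)
    _ = b * #S := by simp [mul_comm]

/-- The weights are `(p + pᵀ) / (2m)`: a row sum and a column sum of `p` add up to something in
`[2m, 2n]`. -/
theorem hasWeighting_of_iso_le {n m : ℕ} (hm : 0 < m) (hmn : m ≤ n)
    (h : ∀ S : Finset V, (iso (deleteVerts G S) : ℝ) ≤ (n : ℝ) / m * #S) :
    HasWeighting G (Set.Ici 0) ((n : ℝ) / m) := by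
  obtain ⟨p, hp, hs⟩ := exists_nat_matrix hmn ((mul_iso_le_iff hm).1 h)
  have hm' : (0 : ℝ) < m := by exact_mod_cast hm
  have hsum (v : V) : ∑ u, ((p v u + p u v : ℕ) : ℝ) / (2 * m) =
      ((∑ u, p v u + ∑ u, p u v : ℕ) : ℝ) / (2 * m) := by
    rw [← sum_div, ← sum_add_distrib]
    push_cast
    rfl
  refine ⟨fun u v ↦ ((p u v + p v u : ℕ) : ℝ) / (2 * m), ?_, ?_, ?_, ?_, ?_⟩
  · intro u v
    rw [add_comm]
  · intro u v
    exact Set.mem_Ici.2 (by positivity)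
  · intro u v huv
    by_contra h
    refine huv ?_
    have h1 : p u v = 0 := by_contra fun h' ↦ h (hp _ _ h')
    have h2 : p v u = 0 := by_contra fun h' ↦ h (hp _ _ h').symm
    simp [h1, h2]
  · intro v
    rw [hsum, le_div_iff₀ (by positivity), one_mul]
    exact_mod_cast (by have := hs v; omega : 2 * m ≤ ∑ u, p v u + ∑ u, p u v)
  · intro v
    rw [hsum, div_le_div_iff₀ (by positivity) hm', ← mul_assoc, mul_comm (n : ℝ) 2]
    refine mul_le_mul_of_nonneg_right ?_ hm'.le
    exact_mod_cast (by have := hs v; omega : ∑ u, p v u + ∑ u, p u v ≤ 2 * n)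

/-- Two colours avoid the factor `1/2`: each edge is read only from colour `0` to colour `1`, so
that a vertex sees either its row or its column of `p`. -/
theorem hasWeighting_grid_of_iso_le {n m : ℕ} (hm : 0 < m) (hmn : m ≤ n) (c : G.Coloring (Fin 2))
    (h : ∀ S : Finset V, (iso (deleteVerts G S) : ℝ) ≤ (n : ℝ) / m * #S) :
    HasWeighting G (grid m) ((n : ℝ) / m) := by
  obtain ⟨p, hp, hs⟩ := exists_nat_matrix hmn ((mul_iso_le_iff hm).1 h)
  have hm' : (0 : ℝ) < m := by exact_mod_cast hm
  have key {u v : V} (h : c u = c v) : p u v = 0 := by_contra fun h' ↦ c.valid (hp _ _ h') h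
  set q : V → V → ℕ := fun u v ↦ if c u = 0 then p u v else p v u with hq
  have hqs (v : V) : m ≤ ∑ u, q v u ∧ ∑ u, q v u ≤ n := by
    by_cases h : c v = 0
    · simpa [hq, h] using (hs v).1
    · simpa [hq, h] using (hs v).2
  have hsum (v : V) : ∑ u, (q v u : ℝ) / m = ((∑ u, q v u : ℕ) : ℝ) / m := by
    rw [← sum_div]
    push_cast
    rfl
  refine ⟨fun u v ↦ (q u v : ℝ) / m, ?_, fun u v ↦ ⟨_, rfl⟩, ?_, ?_, ?_⟩
  · intro u v
    congr 2
    by_cases huv : c u = c v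
    · simp [hq, key huv, key huv.symm]
    · by_cases hu : c u = 0
      · have hv : c v ≠ 0 := fun hv ↦ huv (hu.trans hv.symm)
        simp [hq, hu, hv]
      · have hv : c v = 0 := by omega
        simp [hq, hu, hv]
  · intro u v huv
    have h : q u v ≠ 0 := fun h ↦ huv (by simp [h])
    simp only [hq] at h
    split_ifs at h
    · exact hp _ _ h
    · exact (hp _ _ h).symm
  · intro v
    rw [hsum, le_div_iff₀ hm', one_mul]
    exact_mod_cast (hqs v).1
  · intro v
    rw [hsum]
    gcongr
    exact (hqs v).2

theorem IsWeighting.of_iso {W : Type*} [Fintype W] {H : SimpleGraph W} {A : Set ℝ} {b : ℝ}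
    {w : W → W → ℝ} (hw : IsWeighting H A b w) (φ : G ≃g H) :
    IsWeighting G A b fun u v ↦ w (φ u) (φ v) where
  symm _ _ := hw.symm _ _
  mem _ _ := hw.mem _ _
  adj _ _ h := φ.map_adj_iff.1 (hw.adj _ _ h)
  one_le v := (hw.one_le (φ v)).trans_eq (φ.toEquiv.sum_comp fun x ↦ w (φ v) x).symm
  le v := (φ.toEquiv.sum_comp fun x ↦ w (φ v) x).trans_le (hw.le (φ v))

theorem HasWeighting.of_iso {W : Type*} [Fintype W] {H : SimpleGraph W} {A : Set ℝ} {b : ℝ}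
    (hw : HasWeighting H A b) (φ : G ≃g H) : HasWeighting G A b :=
  hw.elim fun _ h ↦ ⟨_, h.of_iso φ⟩

end

/-! ### Gluing and restricting weightings along components -/

section Components

variable {V : Type*} [Fintype V] {F : SimpleGraph V} [∀ c : F.ConnectedComponent, Fintype c]
  {A : Set ℝ} {b : ℝ}

open Classical in
/-- The weights on `F` obtained from weights on its components. -/
noncomputable def glue (w : ∀ c : F.ConnectedComponent, c → c → ℝ) (u v : V) : ℝ :=
  if h : F.connectedComponentMk v = F.connectedComponentMk u then
    w (F.connectedComponentMk u) ⟨u, rfl⟩ ⟨v, h⟩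
  else 0

omit [Fintype V] [∀ c : F.ConnectedComponent, Fintype c] in
theorem glue_coe (w : ∀ c : F.ConnectedComponent, c → c → ℝ) {c : F.ConnectedComponent}
    (u v : c) : glue w u v = w c u v := by
  obtain ⟨u, hu⟩ := u
  obtain ⟨v, hv⟩ := v
  change F.connectedComponentMk u = c at hu
  subst hu
  exact dif_pos hv

omit [Fintype V] [∀ c : F.ConnectedComponent, Fintype c] in
theorem glue_of_ne (w : ∀ c : F.ConnectedComponent, c → c → ℝ) {u v : V}
    (h : F.connectedComponentMk v ≠ F.connectedComponentMk u) : glue w u v = 0 :=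
  dif_neg h

theorem sum_glue (w : ∀ c : F.ConnectedComponent, c → c → ℝ) {c : F.ConnectedComponent}
    (v : c) : ∑ u, glue w v u = ∑ u, w c v u := by
  symm
  refine sum_of_injOn Subtype.val Subtype.val_injective.injOn (by simp) ?_ ?_
  · intro u _ hu
    refine glue_of_ne w fun h ↦ hu ?_
    have hu' : u ∈ c := h.trans v.2
    exact ⟨⟨u, hu'⟩, by simp⟩
  · intro u _
    exact (glue_coe w v u).symm

theorem isWeighting_glue (hA : (0 : ℝ) ∈ A) {w : ∀ c : F.ConnectedComponent, c → c → ℝ}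
    (hw : ∀ c, IsWeighting c.toSimpleGraph A b (w c)) : IsWeighting F A b (glue w) := by
  have key (u v : V) : glue w u v = 0 ∨ ∃ (c : F.ConnectedComponent) (u' v' : c),
      u = u' ∧ v = v' := by
    by_cases h : F.connectedComponentMk v = F.connectedComponentMk u
    · exact Or.inr ⟨_, ⟨u, rfl⟩, ⟨v, h⟩, rfl, rfl⟩
    · exact Or.inl (glue_of_ne w h)
  refine ⟨fun u v ↦ ?_, fun u v ↦ ?_, fun u v ↦ ?_, fun v ↦ ?_, fun v ↦ ?_⟩
  · rcases key u v with h | ⟨c, u, v, rfl, rfl⟩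
    · rcases key v u with h' | ⟨c, u, v, rfl, rfl⟩
      · rw [h, h']
      · rw [glue_coe, glue_coe, (hw c).symm]
    · rw [glue_coe, glue_coe, (hw c).symm]
  · rcases key u v with h | ⟨c, u, v, rfl, rfl⟩
    · rwa [h]
    · rw [glue_coe]
      exact (hw c).mem u v
  · rcases key u v with h | ⟨c, u, v, rfl, rfl⟩
    · exact fun h' ↦ absurd h h'
    · rw [glue_coe]
      exact fun h ↦ (hw c).adj u v h
  · have := (hw _).one_le ⟨v, (rfl : F.connectedComponentMk v = F.connectedComponentMk v)⟩
    rwa [← sum_glue w] at this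
  · have := (hw _).le ⟨v, (rfl : F.connectedComponentMk v = F.connectedComponentMk v)⟩
    rwa [← sum_glue w] at this

theorem IsWeighting.component {w : V → V → ℝ} (hw : IsWeighting F A b w)
    (c : F.ConnectedComponent) : IsWeighting c.toSimpleGraph A b fun u v ↦ w u v := by
  have hsum (v : c) : ∑ u : c, w v u = ∑ u, w v u := by
    refine sum_of_injOn Subtype.val Subtype.val_injective.injOn (by simp) ?_ fun _ _ ↦ rfl
    intro u _ hu
    by_contra h
    have h1 : F.connectedComponentMk (v : V) = F.connectedComponentMk u :=
      ConnectedComponent.connectedComponentMk_eq_of_adj (hw.adj v u h)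
    have hu' : u ∈ c := h1.symm.trans v.2
    exact hu ⟨⟨u, hu'⟩, by simp⟩
  exact ⟨fun _ _ ↦ hw.symm _ _, fun _ _ ↦ hw.mem _ _, fun _ _ h ↦ hw.adj _ _ h,
    fun v ↦ (hw.one_le v).trans_eq (hsum v).symm, fun v ↦ (hsum v).trans_le (hw.le v)⟩

end Components

/-! ### Tight graphs and the incidence map -/

/-- `K` has nonnegative weightings, and none of them vanishes on an edge. -/
structure IsTight {V : Type*} [Fintype V] (K : SimpleGraph V) (b : ℝ) : Prop where
  exists_weighting : HasWeighting K (Set.Ici 0) b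
  ne_zero : ∀ w, IsWeighting K (Set.Ici 0) b w → ∀ u v, K.Adj u v → w u v ≠ 0

/-- A weighting of one component extends to the whole graph by keeping a fixed weighting on the
others. -/
theorem IsTight.component {V : Type*} [Fintype V] {F : SimpleGraph V} {b : ℝ}
    [∀ c : F.ConnectedComponent, Fintype c] (hF : IsTight F b) (c : F.ConnectedComponent) :
    IsTight c.toSimpleGraph b := by
  classical
  obtain ⟨w, hw⟩ := hF.exists_weighting
  refine ⟨⟨_, hw.component c⟩, fun w' hw' u v huv ↦ ?_⟩
  have h := isWeighting_glue (w := Function.update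
    (fun (c : F.ConnectedComponent) (u v : c) ↦ w u v) c w') (Set.mem_Ici.2 le_rfl) fun d ↦ by
      by_cases hd : d = c
      · subst hd
        rwa [Function.update_self]
      · rw [Function.update_of_ne hd]
        exact hw.component d
  have h' := hF.ne_zero _ h u v huv
  rwa [glue_coe, Function.update_self] at h'

/-- A subgraph minimal among those with a weighting is tight, because an edge of weight `0` could be
deleted. -/
theorem exists_isTight_le {V : Type*} [Fintype V] {G : SimpleGraph V} {b : ℝ}
    (hG : HasWeighting G (Set.Ici 0) b) : ∃ F ≤ G, IsTight F b := by
  obtain ⟨F, hF⟩ := exists_minimal_of_wellFoundedLT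
    (fun F : SimpleGraph V ↦ F ≤ G ∧ HasWeighting F (Set.Ici 0) b) ⟨G, le_rfl, hG⟩
  refine ⟨F, hF.prop.1, hF.prop.2, fun w hw u v huv h0 ↦ ?_⟩
  have h1 : HasWeighting (F.deleteEdges {s(u, v)}) (Set.Ici 0) b :=
    ⟨w, hw.symm, hw.mem, fun a b hab ↦ by
      rw [deleteEdges_adj]
      refine ⟨hw.adj a b hab, fun h ↦ hab ?_⟩
      rcases Sym2.eq_iff.1 h with ⟨rfl, rfl⟩ | ⟨rfl, rfl⟩
      · exact h0
      · rw [hw.symm, h0], hw.one_le, hw.le⟩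
  have h2 := hF.le_of_le ⟨(deleteEdges_le _).trans hF.prop.1, h1⟩ (deleteEdges_le _)
  simpa [deleteEdges_adj] using h2 huv

section Tight

variable {V : Type*} [Fintype V] {K : SimpleGraph V} {b : ℝ}

theorem IsTight.not_hasWeighting_deleteEdges (hK : IsTight K b) {e : Sym2 V} (he : e ∈ K.edgeSet) :
    ¬ HasWeighting (K.deleteEdges {e}) (Set.Ici 0) b := by
  rintro ⟨w, hw⟩
  induction e using Sym2.ind with
  | _ u v =>
    refine hK.ne_zero w ⟨hw.symm, hw.mem, fun _ _ h ↦ deleteEdges_le _ (hw.adj _ _ h), hw.one_le,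
      hw.le⟩ u v he ?_
    by_contra h
    simpa [deleteEdges_adj] using hw.adj u v h

/-- If `x` had a negative entry, a weighting could be moved in direction `x` until some edge reaches
weight `0`, against tightness. The sum may grow only at vertices with at most one neighbour, where
truncation at `1` keeps it within `b`. -/
theorem IsTight.nonneg (hK : IsTight K b) (hb : 1 ≤ b) {x : V → V → ℝ}
    (hsymm : ∀ u v, x u v = x v u) (hadj : ∀ u v, x u v ≠ 0 → K.Adj u v)
    (hx : ∀ v, ∑ u, x v u = 0 ∨ 0 ≤ ∑ u, x v u ∧ (K.neighborSet v).Subsingleton) (u v : V) :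
    0 ≤ x u v := by
  classical
  by_contra huv
  obtain ⟨w, hw⟩ := hK.exists_weighting
  have hw0 (u v : V) : 0 ≤ w u v := hw.mem u v
  obtain ⟨p, hp, hmin⟩ := exists_min_image ({p | x p.1 p.2 < 0} : Finset (V × V))
    (fun p ↦ w p.1 p.2 / -x p.1 p.2) ⟨(u, v), by simpa using huv⟩
  simp only [mem_filter, mem_univ, true_and] at hp hmin
  -- The ratio test: `t` is the largest step that keeps all entries nonnegative, and the entry at
  -- `p` becomes `0`.
  set t : ℝ := w p.1 p.2 / -x p.1 p.2 with ht
  have ht0 : 0 ≤ t := div_nonneg (hw0 _ _) (by linarith)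
  have hnn (u v : V) : 0 ≤ w u v + t * x u v := by
    by_cases h : x u v < 0
    · have := hmin (u, v) h
      rw [le_div_iff₀ (by linarith)] at this
      linarith
    · exact add_nonneg (hw0 u v) (mul_nonneg ht0 (not_lt.1 h))
  have hsum (v : V) : ∑ u, (w v u + t * x v u) = ∑ u, w v u + t * ∑ u, x v u := by
    rw [sum_add_distrib, mul_sum]
  have hz (u v : V) (h : ¬ K.Adj u v) : w u v + t * x u v = 0 := by
    have h1 : w u v = 0 := by_contra fun h' ↦ h (hw.adj _ _ h')
    have h2 : x u v = 0 := by_contra fun h' ↦ h (hadj _ _ h')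
    simp [h1, h2]
  refine hK.ne_zero (fun u v ↦ min (w u v + t * x u v) 1) ⟨?_, ?_, ?_, ?_, ?_⟩ p.1 p.2
    (hadj _ _ hp.ne) ?_
  · intro u v
    rw [hw.symm, hsymm]
  · exact fun u v ↦ le_min (hnn u v) zero_le_one
  · intro u v h
    by_contra h'
    exact h (by simp [hz u v h'])
  · intro v
    refine one_le_sum_min (hnn v) ?_
    rw [hsum]
    have := hw.one_le v
    rcases hx v with h | h
    · rw [h]; linarith
    · linarith [mul_nonneg ht0 h.1]
  · intro v
    rcases hx v with h | h
    · refine (sum_le_sum fun u _ ↦ min_le_left _ _).trans ?_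
      rw [hsum, h, mul_zero, add_zero]
      exact hw.le v
    · refine le_trans ?_ hb
      by_cases hn : ∃ u, K.Adj v u
      · obtain ⟨u, hu⟩ := hn
        rw [sum_eq_single u]
        · exact min_le_right _ _
        · intro a _ ha
          rw [hz v a fun h' ↦ ha (h.2 h' hu)]
          simp
        · simp
      · push Not at hn
        rw [sum_eq_zero fun u _ ↦ by simp [hz v u (hn u)]]
        exact zero_le_one
  · have : w p.1 p.2 + t * x p.1 p.2 = 0 := by
      rw [ht]
      have : x p.1 p.2 ≠ 0 := hp.ne
      field_simp
      ring
    simp [this]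

/-- The incidence map, from edge functions to vertex functions. -/
noncomputable def incidenceMap (K : SimpleGraph V) : (K.edgeSet → ℝ) →ₗ[ℝ] (V → ℝ) where
  toFun z v := ∑ u, edgeMatrix K z v u
  map_add' z z' := by
    ext v
    simp only [Pi.add_apply, ← sum_add_distrib]
    refine sum_congr rfl fun u _ ↦ ?_
    unfold edgeMatrix
    split_ifs <;> simp
  map_smul' r z := by
    ext v
    simp only [Pi.smul_apply, smul_eq_mul, RingHom.id_apply, mul_sum]
    refine sum_congr rfl fun u _ ↦ ?_
    unfold edgeMatrix
    split_ifs <;> simp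

/-- A kernel element is nonnegative by `IsTight.nonneg` and has zero vertex sums, hence vanishes. -/
theorem IsTight.injective_incidenceMap (hK : IsTight K b) (hb : 1 ≤ b) :
    Function.Injective (incidenceMap K) := by
  rw [← LinearMap.ker_eq_bot, LinearMap.ker_eq_bot']
  intro z hz
  have hv (v : V) : ∑ u, edgeMatrix K z v u = 0 := congrFun hz v
  have h0 := hK.nonneg hb (edgeMatrix_symm z) (edgeMatrix_adj z) fun v ↦ Or.inl (hv v)
  ext ⟨e, he⟩
  induction e using Sym2.ind with
  | _ u v =>
    have := (sum_eq_zero_iff_of_nonneg fun u _ ↦ h0 _ u).1 (hv u) v (mem_univ v)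
    rwa [edgeMatrix, dif_pos (show K.Adj u v from he)] at this

theorem IsTight.card_edgeSet_le (hK : IsTight K b) (hb : 1 ≤ b) :
    Nat.card K.edgeSet ≤ Nat.card V := by
  classical
  have := LinearMap.finrank_le_finrank_of_injective (hK.injective_incidenceMap hb)
  simpa [Nat.card_eq_fintype_card] using this

theorem IsTight.surjective_incidenceMap (hK : IsTight K b) (hb : 1 ≤ b)
    (hcard : Nat.card K.edgeSet = Nat.card V) : Function.Surjective (incidenceMap K) := by
  classical
  refine (LinearMap.injective_iff_surjective_of_finrank_eq_finrank ?_).1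
    (hK.injective_incidenceMap hb)
  simpa [Nat.card_eq_fintype_card] using hcard

/-- Take a preimage of the indicator of `v` under the incidence map. If `v` had at most one
neighbour, the preimage would be nonnegative; its sums vanish at all vertices other than `v`, hence
so do all edges at `v`, although the sum there is `1`. -/
theorem IsTight.not_subsingleton_neighborSet (hK : IsTight K b) (hb : 1 ≤ b)
    (hcard : Nat.card K.edgeSet = Nat.card V) (v : V) : ¬ (K.neighborSet v).Subsingleton := by
  classical
  intro hv
  obtain ⟨z, hz⟩ := hK.surjective_incidenceMap hb hcard (Pi.single v 1)
  have hz' (u : V) : ∑ a, edgeMatrix K z u a = (Pi.single v 1 : V → ℝ) u := congrFun hz u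
  have h0 := hK.nonneg hb (edgeMatrix_symm z) (edgeMatrix_adj z) fun u ↦ by
    by_cases h : u = v
    · subst h
      right
      rw [hz', Pi.single_eq_same]
      exact ⟨zero_le_one, hv⟩
    · left
      rw [hz', Pi.single_eq_of_ne h]
  have h1 : ∑ a, edgeMatrix K z v a = 0 := by
    refine sum_eq_zero fun a _ ↦ ?_
    by_cases h : a = v
    · subst h
      exact dif_neg (K.loopless.irrefl a)
    · rw [edgeMatrix_symm]
      refine (sum_eq_zero_iff_of_nonneg fun u _ ↦ h0 a u).1 ?_ v (mem_univ v)
      rw [hz', Pi.single_eq_of_ne h]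
  rw [hz', Pi.single_eq_same] at h1
  exact one_ne_zero h1

/-- For a bipartite graph the `±1` vector of the colour classes is orthogonal to the image of the
incidence map, which is then not surjective. -/
theorem IsTight.isEmpty_coloring (hK : IsTight K b) (hb : 1 ≤ b) [Nonempty V]
    (hcard : Nat.card K.edgeSet = Nat.card V) : IsEmpty (K.Coloring Bool) := by
  classical
  refine ⟨fun c ↦ ?_⟩
  obtain ⟨v⟩ := ‹Nonempty V›
  obtain ⟨z, hz⟩ := hK.surjective_incidenceMap hb hcard (Pi.single v 1)
  have hz' (u : V) : ∑ a, edgeMatrix K z u a = (Pi.single v 1 : V → ℝ) u := congrFun hz u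
  set s : V → ℝ := fun u ↦ if c u then 1 else -1 with hs
  have h1 : ∑ u, s u * ∑ a, edgeMatrix K z u a = s v := by
    simp [hz', Pi.single_apply]
  have h2 : ∑ u, s u * ∑ a, edgeMatrix K z u a = -∑ u, s u * ∑ a, edgeMatrix K z u a := by
    simp_rw [mul_sum]
    conv_lhs => rw [sum_comm]
    simp_rw [← sum_neg_distrib]
    refine sum_congr rfl fun u _ ↦ sum_congr rfl fun a _ ↦ ?_
    by_cases h : K.Adj u a
    · have := c.valid h
      rw [edgeMatrix_symm]
      cases hu : c u <;> cases ha : c a <;> simp_all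
    · have h3 : edgeMatrix K z u a = 0 := by_contra fun h' ↦ h (edgeMatrix_adj z u a h')
      rw [edgeMatrix_symm, h3]
      simp
  have h3 : s v = 0 := by linarith
  simp only [hs] at h3
  split_ifs at h3 <;> norm_num at h3

end Tight

/-! ### Weightings of circuits -/

/-- The weights on a circuit giving the edge from `a` to `a + 1` the weight `f a`. -/
def circuitWeight {k : ℕ} (f : Fin (k + 3) → ℝ) (a c : Fin (k + 3)) : ℝ :=
  (if c = a + 1 then f a else 0) + if a = c + 1 then f c else 0

theorem sum_circuitWeight {k : ℕ} (f : Fin (k + 3) → ℝ) (a : Fin (k + 3)) :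
    ∑ c, circuitWeight f a c = f a + f (a - 1) := by
  simp_rw [circuitWeight, sum_add_distrib]
  congr 1
  · simp
  · rw [sum_eq_single (a - 1)]
    · simp
    · intro c _ hc
      exact if_neg fun h ↦ hc (by simp [h])
    · simp

theorem isWeighting_circuitWeight {k : ℕ} {A : Set ℝ} {b : ℝ} {f : Fin (k + 3) → ℝ}
    (hA : (0 : ℝ) ∈ A) (hadd : ∀ x ∈ A, ∀ y ∈ A, x + y ∈ A) (hf : ∀ a, f a ∈ A)
    (h1 : ∀ a, 1 ≤ f a + f (a - 1)) (h2 : ∀ a, f a + f (a - 1) ≤ b) :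
    IsWeighting (cycleGraph (k + 3)) A b (circuitWeight f) where
  symm _ _ := add_comm _ _
  mem a c := by
    refine hadd _ ?_ _ ?_
    · split_ifs <;> simp [hA, hf]
    · split_ifs <;> simp [hA, hf]
  adj a c h := by
    rw [cycleGraph_adj]
    by_contra h'
    push Not at h'
    refine h ?_
    rw [circuitWeight, if_neg fun h ↦ h'.2 (by simp [h]), if_neg fun h ↦ h'.1 (by simp [h]),
      add_zero]
  one_le a := (h1 a).trans_eq (sum_circuitWeight f a).symm
  le a := (sum_circuitWeight f a).trans_le (h2 a)

theorem fin_val_sub_one {k : ℕ} (a : Fin (k + 3)) :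
    (a = 0 ∧ (a - 1).val = k + 2) ∨ (a.val = (a - 1).val + 1) := by
  by_cases h : a = 0
  · left
    subst h
    exact ⟨rfl, by rw [Fin.val_sub]; simp⟩
  · right
    rw [Fin.val_sub_one_of_ne_zero h]
    have := Fin.pos_iff_ne_zero.2 h
    rw [Fin.lt_def] at this
    simp at this
    omega

theorem zero_mem_grid (m : ℕ) : (0 : ℝ) ∈ grid m := ⟨0, by simp⟩

theorem add_mem_grid {m : ℕ} : ∀ x ∈ grid m, ∀ y ∈ grid m, x + y ∈ grid m := by
  rintro _ ⟨k, rfl⟩ _ ⟨l, rfl⟩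
  exact ⟨k + l, by push_cast; ring⟩

/-- Edges alternate between `⌈m/2⌉` and `⌊m/2⌋`, in units of `1/m`. Only at vertex `0` do two edges
of the larger kind meet, with sum at most `m + 1 ≤ n`. -/
theorem hasWeighting_cycleGraph {n m : ℕ} (hm : 0 < m) (hmn : m < n) (j : ℕ) :
    HasWeighting (cycleGraph (2 * j + 3)) (grid m) ((n : ℝ) / m) := by
  have hm' : (0 : ℝ) < m := by exact_mod_cast hm
  set g : Fin (2 * j + 3) → ℕ := fun a ↦ if Even a.val then (m + 1) / 2 else m / 2 with hg
  have key (a : Fin (2 * j + 3)) : m ≤ g a + g (a - 1) ∧ g a + g (a - 1) ≤ n := by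
    rcases fin_val_sub_one a with h | h
    · have h1 : Even a.val := by simp [h.1]
      have h2 : Even (a - 1).val := by rw [h.2]; exact ⟨j + 1, by ring⟩
      simp only [hg, h1, h2, if_true]
      omega
    · by_cases h2 : Even (a - 1).val
      · have h1 : ¬ Even a.val := by rw [h, Nat.even_add_one]; exact not_not.2 h2
        simp only [hg, h1, h2, if_true, if_false]
        omega
      · have h1 : Even a.val := by rw [h, Nat.even_add_one]; exact h2
        simp only [hg, h1, h2, if_true, if_false]
        omega
  refine ⟨_, isWeighting_circuitWeight (f := fun a ↦ (g a : ℝ) / m) (zero_mem_grid m) add_mem_grid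
    (fun a ↦ ⟨_, rfl⟩) (fun a ↦ ?_) fun a ↦ ?_⟩
  · rw [← add_div, le_div_iff₀ hm', one_mul]
    exact_mod_cast (key a).1
  · rw [← add_div]
    gcongr
    exact_mod_cast (key a).2

/-- A long odd circuit has a weighting that vanishes on one of its edges. -/
theorem not_isTight_cycleGraph {j : ℕ} {b : ℝ} (hb : 1 + 1 / ((j : ℝ) + 1) ≤ b) :
    ¬ IsTight (cycleGraph (2 * j + 3)) b := by
  intro h
  have hj : (0 : ℝ) < (j : ℝ) + 1 := by positivity
  -- Even edges descend from `1` to `0` and odd edges ascend from `1/(j+1)` to `1`, in steps of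
  -- `1/(j+1)`. Vertex sums alternate between `1` and `1 + 1/(j+1)`, and the last edge gets weight
  -- `0`.
  set f : Fin (2 * j + 3) → ℝ := fun a ↦
    if Even a.val then 1 - ((a.val / 2 : ℕ) : ℝ) / (j + 1)
    else (((a.val + 1) / 2 : ℕ) : ℝ) / (j + 1) with hf
  have hlast : f (Fin.last _) = 0 := by
    have h1 : Even (2 * j + 2) := ⟨j + 1, by ring⟩
    have h2 : (2 * j + 2) / 2 = j + 1 := by omega
    simp only [hf, Fin.val_last, h1, if_true, h2]
    push_cast
    rw [div_self hj.ne', sub_self]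
  have key (a : Fin (2 * j + 3)) : f a + f (a - 1) = 1 ∨ f a + f (a - 1) = 1 + 1 / (j + 1) := by
    rcases fin_val_sub_one a with h | h
    · have h1 : a - 1 = Fin.last _ := Fin.ext h.2
      rw [h1, hlast, h.1]
      left
      simp [hf]
    · by_cases h2 : Even (a - 1).val
      · right
        have h1 : ¬ Even a.val := by rw [h, Nat.even_add_one]; exact not_not.2 h2
        simp only [hf, h1, h2, if_true, if_false]
        have h3 : (a.val + 1) / 2 = (a - 1).val / 2 + 1 := by omega
        rw [h3]
        push_cast
        ring
      · left
        have h1 : Even a.val := by rw [h, Nat.even_add_one]; exact h2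
        simp only [hf, h1, h2, if_true, if_false]
        rw [← h]
        ring
  have hpos : (0 : ℝ) < 1 / ((j : ℝ) + 1) := by positivity
  refine h.ne_zero _ (isWeighting_circuitWeight (f := f) (Set.mem_Ici.2 le_rfl)
    (fun x hx y hy ↦ add_nonneg (Set.mem_Ici.1 hx) hy) (fun a ↦ ?_) (fun a ↦ ?_) fun a ↦ ?_)
    (Fin.last _) 0 ?_ ?_
  · rw [Set.mem_Ici]
    simp only [hf]
    split_ifs
    · rw [sub_nonneg, div_le_one hj]
      have : a.val / 2 ≤ j + 1 := by have := a.isLt; omega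
      exact_mod_cast this
    · positivity
  · rcases key a with h | h <;> rw [h]
    linarith
  · rcases key a with h | h <;> rw [h]
    · linarith
    · exact hb
  · rw [cycleGraph_adj]
    right
    simp
  · have h1 : Fin.last (2 * j + 2) ≠ 0 + 1 := by
      rw [Ne, Fin.ext_iff, zero_add, Fin.val_last, Fin.val_one]
      omega
    rw [circuitWeight, hlast, if_neg h1, ite_self, add_zero]

/-! ### Connected tight graphs are trees or odd circuits -/

theorem nonempty_iso_cycleGraph {V : Type*} [Fintype V] {K : SimpleGraph V} (hc : K.Connected)
    (h2 : ∀ v, (K.neighborSet v).ncard = 2) :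
    ∃ k, Nonempty (K ≃g cycleGraph (k + 3)) := by
  classical
  obtain ⟨v⟩ := hc.nonempty
  obtain ⟨p, hp, hverts⟩ := IsCycles.exists_cycle_toSubgraph_verts_eq_connectedComponentSupp
    (G := K) (c := K.connectedComponentMk v) (fun v _ ↦ h2 v) rfl
    (Set.nonempty_of_ncard_ne_zero (by simp [h2 v]))
  have hmem (u : V) : u ∈ p.support := by
    rw [← Walk.mem_verts_toSubgraph, hverts]
    exact ConnectedComponent.sound (hc.preconnected u v)
  obtain ⟨k, hk⟩ := Nat.exists_eq_add_of_le' hp.three_le_length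
  obtain ⟨f⟩ := (cycleGraph_isContained_iff (G := K) (n := p.length) (by omega)).2 ⟨v, p, hp, rfl⟩
  rw [hk] at f
  have hcard : Fintype.card V ≤ k + 3 := by
    have h1 : (univ : Finset V) ⊆ p.support.tail.toFinset := fun u _ ↦ by
      rw [List.mem_toFinset]
      by_cases hu : u = v
      · subst hu
        exact p.end_mem_tail_support hp.not_nil
      · exact (Walk.mem_support_iff p |>.1 (hmem u)).resolve_left hu
    have h3 := (card_le_card h1).trans (List.toFinset_card_le _)
    simpa [hk] using h3
  have hbij : Function.Bijective f.toHom :=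
    (Fintype.bijective_iff_injective_and_card _).2 ⟨f.injective, le_antisymm
      (Fintype.card_le_of_injective _ f.injective) (by simpa using hcard)⟩
  refine ⟨k, ⟨RelIso.symm ⟨Equiv.ofBijective _ hbij, fun {a c} ↦ ⟨fun h ↦ ?_, fun h ↦
    f.toHom.map_adj h⟩⟩⟩⟩
  -- Both graphs are 2-regular, so an injective homomorphism maps neighbourhoods onto neighbourhoods
  -- and thus reflects adjacency.
  have himg : f.toHom '' (cycleGraph (k + 3)).neighborSet a = K.neighborSet (f.toHom a) := by
    refine Set.eq_of_subset_of_ncard_le ?_ ?_ (Set.toFinite _)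
    · rintro _ ⟨x, hx, rfl⟩
      exact f.toHom.map_adj hx
    · rw [Set.ncard_image_of_injective _ f.injective, h2, ← Nat.card_coe_set_eq,
        Nat.card_eq_fintype_card, card_neighborSet_eq_degree, cycleGraph_degree_three_le]
  have h' : f.toHom c ∈ f.toHom '' (cycleGraph (k + 3)).neighborSet a := by
    rw [himg]
    exact h
  obtain ⟨x, hx, hxc⟩ := h'
  rwa [← f.injective hxc]

/-- Connectedness gives `|V| ≤ |E| + 1` and tightness `|E| ≤ |V|`. If `|E| = |V|`, the average
degree is `2` while each degree is at least `2`. -/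
theorem IsTight.isTree_or_ncard_neighborSet {V : Type*} [Fintype V] {K : SimpleGraph V} {b : ℝ}
    (hK : IsTight K b) (hb : 1 ≤ b) (hc : K.Connected) :
    K.IsTree ∨ (Nat.card K.edgeSet = Nat.card V ∧ ∀ v, (K.neighborSet v).ncard = 2) := by
  classical
  have h1 := hK.card_edgeSet_le hb
  have h2 := hc.card_vert_le_card_edgeSet_add_one
  by_cases h : Nat.card K.edgeSet = Nat.card V
  · right
    refine ⟨h, ?_⟩
    have hdeg (v : V) : (K.neighborSet v).ncard = K.degree v := by
      rw [← Nat.card_coe_set_eq, Nat.card_eq_fintype_card, card_neighborSet_eq_degree]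
    have htwo (v : V) : 2 ≤ K.degree v := by
      rw [← hdeg]
      exact Set.one_lt_ncard_iff_nontrivial.2
        (Set.not_subsingleton_iff.1 (hK.not_subsingleton_neighborSet hb h v))
    have hsum : ∑ v, K.degree v = ∑ v : V, 2 := by
      have hE : #K.edgeFinset = Fintype.card V := by
        rw [edgeFinset_card, ← Nat.card_eq_fintype_card, h, Nat.card_eq_fintype_card]
      rw [K.sum_degrees_eq_twice_card_edges, hE]
      simp [mul_comm]
    intro v
    rw [hdeg]
    exact ((sum_eq_sum_iff_of_le fun v _ ↦ htwo v).1 hsum.symm v (mem_univ v)).symm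
  · left
    exact isTree_iff_connected_and_card.2 ⟨hc, by omega⟩

theorem IsTight.of_iso {V W : Type*} [Fintype V] [Fintype W] {K : SimpleGraph V}
    {H : SimpleGraph W} {b : ℝ} (hK : IsTight K b) (φ : K ≃g H) : IsTight H b where
  exists_weighting := hK.exists_weighting.of_iso φ.symm
  ne_zero w hw u v huv := by
    have h := hK.ne_zero _ (hw.of_iso φ) (φ.symm u) (φ.symm v) (φ.symm.map_adj_iff.2 huv)
    simpa using h

theorem IsTight.exists_mem_families {V : Type*} [Fintype V] {K : SimpleGraph V} {n m : ℕ}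
    (hm : 0 < m) (hmn : m < n) (hK : IsTight K ((n : ℝ) / m)) (hc : K.Connected) :
    ∃ H ∈ oddCircuitFamily n m ∪ treeFamily n m, Nonempty (K ≃g H.2) := by
  have hm' : (0 : ℝ) < m := by exact_mod_cast hm
  have hmn' : (m : ℝ) < n := by exact_mod_cast hmn
  have hb : (1 : ℝ) ≤ (n : ℝ) / m := by
    rw [le_div_iff₀ hm', one_mul]
    exact hmn'.le
  rcases hK.isTree_or_ncard_neighborSet hb hc with h | ⟨hcard, h⟩
  · have φ := K.overFinIso rfl
    have hT := hK.of_iso φ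
    refine ⟨⟨_, K.overFin rfl⟩, Or.inr ⟨φ.isTree_iff.1 h, ?_, fun e he ↦ ?_⟩, ⟨φ⟩⟩
    · obtain ⟨w, hw⟩ := hT.exists_weighting
      exact hw.iso_le
    · by_contra hS
      push Not at hS
      exact hT.not_hasWeighting_deleteEdges he (hasWeighting_of_iso_le hm hmn.le hS)
  · obtain ⟨k, ⟨φ⟩⟩ := nonempty_iso_cycleGraph hc h
    have := hc.nonempty
    have hodd : ¬ Even (k + 3) := fun heven ↦
      (hK.isEmpty_coloring hb hcard).false
        ((cycleGraph.bicoloring_of_even _ heven).comp φ.toHom)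
    obtain ⟨j, rfl⟩ : ∃ j, k = 2 * j := by
      rw [Nat.even_add_one, not_not, Nat.even_add] at hodd
      exact (hodd.2 even_two).exists_two_nsmul _
    refine ⟨⟨_, cycleGraph (2 * (j + 1) + 1)⟩, Or.inl ⟨j + 1, by omega, ?_, rfl⟩, ⟨φ⟩⟩
    -- With `i = j + 1`, the inequality `m/(n-m) ≤ i` says that `1 + 1/i ≤ n/m`, the bound in
    -- `not_isTight_cycleGraph`.
    by_contra hlt
    rw [not_lt, div_le_iff₀ (by linarith)] at hlt
    refine not_isTight_cycleGraph (j := j) (b := (n : ℝ) / m) ?_ (hK.of_iso φ)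
    push_cast at hlt
    have hj : (0 : ℝ) < (j : ℝ) + 1 := by positivity
    rw [← sub_nonneg]
    have : (n : ℝ) / m - (1 + 1 / ((j : ℝ) + 1)) =
        (((j : ℝ) + 1) * (n - m) - m) / (m * (j + 1)) := by
      field_simp
      ring
    rw [this]
    exact div_nonneg (by linarith) (by positivity)

/-! ### Component factors versus weightings -/

theorem hasWeighting_grid_of_mem_families {n m : ℕ} (hm : 0 < m) (hmn : m < n)
    {H : Σ k : ℕ, SimpleGraph (Fin k)} (hH : H ∈ oddCircuitFamily n m ∪ treeFamily n m) :
    HasWeighting H.2 (grid m) ((n : ℝ) / m) := by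
  rcases hH with ⟨i, hi, -, rfl⟩ | ⟨hT, hS, -⟩
  · obtain ⟨j, rfl⟩ := Nat.exists_eq_add_of_le' hi
    exact hasWeighting_cycleGraph hm hmn j
  · exact hasWeighting_grid_of_iso_le hm hmn.le hT.coloringTwo hS

theorem IsComponentFactor.hasWeighting {V : Type*} [Fintype V] {G F : SimpleGraph V} {n m : ℕ}
    (hm : 0 < m) (hmn : m < n)
    (hF : IsComponentFactor G (oddCircuitFamily n m ∪ treeFamily n m) F) :
    HasWeighting G (grid m) ((n : ℝ) / m) := by
  have : ∀ c : F.ConnectedComponent, Fintype c := fun c ↦ Fintype.ofFinite _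
  have h (c : F.ConnectedComponent) : HasWeighting c.toSimpleGraph (grid m) ((n : ℝ) / m) := by
    obtain ⟨H, hH, ⟨φ⟩⟩ := hF.2 c
    exact (hasWeighting_grid_of_mem_families hm hmn hH).of_iso φ
  choose w hw using h
  have hg := isWeighting_glue (zero_mem_grid m) hw
  exact ⟨_, hg.symm, hg.mem, fun u v h ↦ hF.1 (hg.adj u v h), hg.one_le, hg.le⟩

theorem HasWeighting.exists_isComponentFactor {V : Type*} [Fintype V] {G : SimpleGraph V}
    {n m : ℕ} (hm : 0 < m) (hmn : m < n) (hG : HasWeighting G (Set.Ici 0) ((n : ℝ) / m)) :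
    ∃ F, IsComponentFactor G (oddCircuitFamily n m ∪ treeFamily n m) F := by
  obtain ⟨F, hFG, hF⟩ := exists_isTight_le hG
  have : ∀ c : F.ConnectedComponent, Fintype c := fun c ↦ Fintype.ofFinite _
  exact ⟨F, hFG, fun c ↦ (hF.component c).exists_mem_families hm hmn c.connected_toSimpleGraph⟩

end IsoFactor

theorem mainTheorem1 {V : Type*} [Fintype V] (G : SimpleGraph V) (n m : ℕ)
    (hm : 0 < m) (hmn : m < n) :
    List.TFAE [
      ∀ S : Finset V, (IsoFactor.iso (IsoFactor.deleteVerts G S) : ℝ) ≤ (n : ℝ) / m * S.card,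
      ∃ h : G.edgeSet → ℝ, IsoFactor.IsFractionalFactor G 1 ((n : ℝ) / m) h,
      ∃ h : G.edgeSet → ℝ, IsoFactor.IsFractionalFactor G 1 ((n : ℝ) / m) h ∧
        ∀ e, ∃ k : ℕ, k ≤ m ∧ h e = (k : ℝ) / m,
      ∃ F : SimpleGraph V, IsoFactor.IsComponentFactor G
        (IsoFactor.oddCircuitFamily n m ∪ IsoFactor.treeFamily n m) F] := by
  tfae_have 1 → 4 := fun h ↦
    (IsoFactor.hasWeighting_of_iso_le hm hmn.le h).exists_isComponentFactor hm hmn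
  tfae_have 4 → 3 := by
    rintro ⟨F, hF⟩
    obtain ⟨w, hw⟩ := hF.hasWeighting hm hmn
    obtain ⟨h, hh, he⟩ := hw.exists_isFractionalFactor (IsoFactor.grid_subset m)
    refine ⟨h, hh, fun e ↦ ?_⟩
    obtain ⟨_, ⟨k, rfl⟩, hx⟩ := he e
    -- Truncating `k/m` at `1 = m/m` stays among the multiples of `1/m`.
    refine ⟨min k m, min_le_right _ _, ?_⟩
    have hm' : (0 : ℝ) < m := by exact_mod_cast hm
    rw [hx, Nat.cast_min, ← min_div_div_right hm'.le, div_self hm'.ne']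
  tfae_have 3 → 2 := fun ⟨h, hh, _⟩ ↦ ⟨h, hh⟩
  tfae_have 2 → 1 := fun ⟨_, hh⟩ ↦ hh.isWeighting.iso_le
  tfae_finish
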